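/- Let $A=(a_1,\ldots,a_n)$ be points of $\mathbb{R}^d$, not necessarily distinct, whose affine span is $\mathbb{R}^d$. Put $v_i=(a_i,1)\in\mathbb{R}^{d+1}$ and $Z(V)=\sum_{i=1}^n[0,v_i]$. For disjoint $I,B\subseteq[n]$ put $\Pi_{I,B}=\sum_{i\in I}v_i+\sum_{b\in B}[0,v_b]$; its faces are the sets $\Pi_{J,C}$ with $C\subseteq B$, $I\subseteq J\subseteq I\cup B$ and $J\cap C=\varnothing$. A fine zonotopal tiling of $Z(V)$ is a collection $\mathcal{P}$ of tiles $\Pi_{I,B}$ (each given with its pair of disjoint index sets $(I,B)$), where $|B|=d+1$ and $(a_b)_{b\in B}$ is affinely independent, whose union is $Z(V)$ and any two of which are disjoint or intersect in a common face $\Pi_{J,C}$, with the same index sets $(J,C)$ in both tiles. A subdivision of a region $R\subseteq\mathbb{R}^d$ is a collection of $d$-dimensional convex polytopes with vertices in $A$ whose union is $R$, any two of which intersect in a common (possibly empty) face; it is a triangulation if all the polytopes are simplices. We say that possibly empty, not necessarily convex regions subdivide $R$ if their union is $R$, their interiors are pairwise disjoint, and each of them has a subdivision such that these subdivisions together form a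 subdivision of $R$. Let $\mathcal{P}$ be a fine zonotopal tiling of $Z(V)$ and let $Q\subseteq[n]$, $k=|Q|$. For $r\ge 0$ let $$\mathcal{E}^{(r)}(Q)=\{\Pi_{I,B}\in\mathcal{P}:\ |I|=r,\ B\cap Q=\varnothing,\ I\subseteq Q\},\qquad \mathcal{T}^{(r)}(Q)=\{\mathrm{ch}(\{a_b\}_{b\in B}):\ \Pi_{I,B}\in\mathcal{E}^{(r)}(Q)\},$$ let $E^{(r)}(Q)$ be the union of the simplices in $\mathcal{T}^{(r)}(Q)$, and let $\mathcal{R}(Q)=E^{(k)}(Q)$ be the link region of $Q$. Let $\mathrm{ch}_Q(A)=\mathrm{ch}(\{a_i\}_{i\notin Q})$. Then: (i) for every $r\ge 0$, $\mathcal{T}^{(r)}(Q)$ is a triangulation of $E^{(r)}(Q)$; (ii) if $\{a_i\}_{i\notin Q}$ affinely spans $\mathbb{R}^d$ (or $Q=[n]$), the regions $E^{(r)}(Q)$, $r\ge 0$, subdivide $\mathrm{ch}_Q(A)$; (iii) under the same condition, $\bigcup_{r\ge 0}\mathcal{T}^{(r)}(Q)$ is a triangulation of $\mathrm{ch}_Q(A)$;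 (iv) $\mathcal{T}^{(k)}(Q)$ is a triangulation of the link region $\mathcal{R}(Q)$. In all four parts the vertices of the polytopes are among the points $a_i$ with $i\notin Q$. -/

import Mathlib

noncomputable section

namespace LinkTiling

variable {d n : ℕ}

/-- The projective lift `(p, 1)` of a point `p ∈ ℝ^d`; the space `ℝ^d × ℝ` plays the role of
`ℝ^(d+1)`. -/
def lift (p : EuclideanSpace ℝ (Fin d)) : EuclideanSpace ℝ (Fin d) × ℝ := (p, 1)

/-- The parallelepiped `Π_{I,B} = ∑_{i ∈ I} v_i + ∑_{b ∈ B} [0, v_b]`, where `v_i = (a_i, 1)`. -/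
def tile (a : Fin n → EuclideanSpace ℝ (Fin d)) (I B : Finset (Fin n)) :
    Set (EuclideanSpace ℝ (Fin d) × ℝ) :=
  {x | ∃ α : Fin n → ℝ, (∀ b ∈ B, α b ∈ Set.Icc (0 : ℝ) 1) ∧
    x = ∑ i ∈ I, lift (a i) + ∑ b ∈ B, α b • lift (a b)}

/-- The zonotope `Z(V) = ∑_{i=1}^n [0, v_i]`. -/
def zonotope (a : Fin n → EuclideanSpace ℝ (Fin d)) : Set (EuclideanSpace ℝ (Fin d) × ℝ) :=
  {x | ∃ α : Fin n → ℝ, (∀ i, α i ∈ Set.Icc (0 : ℝ) 1) ∧ x = ∑ i, α i • lift (a i)}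

/-- `Π_{J,C}` is a face of `Π_{I,B}`: it arises from `Π_{I,B}` by fixing the coefficients of the
segments `[0, v_b]`, `b ∈ B \ C`, to be `1` for `b ∈ J` and `0` for `b ∉ J`. -/
def IsTileFace (J C I B : Finset (Fin n)) : Prop :=
  C ⊆ B ∧ I ⊆ J ∧ J ⊆ I ∪ B ∧ Disjoint J C

/-- A fine zonotopal tiling of `Z(V)`: a collection of full-dimensional parallelepipeds `Π_{I,B}`,
each given by its pair of index sets `(I, B)`, that cover `Z(V)` and meet face to face. The common
faces are faces `Π_{J,C}` with the same index sets `(J, C)` in both tiles. -/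
structure IsFineZonotopalTiling (a : Fin n → EuclideanSpace ℝ (Fin d))
    (P : Set (Finset (Fin n) × Finset (Fin n))) : Prop where
  disjoint : ∀ t ∈ P, Disjoint t.1 t.2
  card_eq : ∀ t ∈ P, t.2.card = d + 1
  affineIndependent : ∀ t ∈ P, AffineIndependent ℝ (fun b : t.2 => a b)
  cover : ⋃ t ∈ P, tile a t.1 t.2 = zonotope a
  face_to_face : ∀ t ∈ P, ∀ t' ∈ P,
    tile a t.1 t.2 ∩ tile a t'.1 t'.2 = ∅ ∨
      ∃ J C : Finset (Fin n), IsTileFace J C t.1 t.2 ∧ IsTileFace J C t'.1 t'.2 ∧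
        tile a t.1 t.2 ∩ tile a t'.1 t'.2 = tile a J C

/-- `𝒯` is a subdivision of the region `R`, with vertices in the point set `A`: a collection of
`d`-dimensional polytopes with vertices in `A`, with union `R`, any two of which meet in a common,
possibly empty, face. -/
structure IsSubdivision (A : Set (EuclideanSpace ℝ (Fin d))) (R : Set (EuclideanSpace ℝ (Fin d)))
    (𝒯 : Set (Set (EuclideanSpace ℝ (Fin d)))) : Prop where
  polytope : ∀ Δ ∈ 𝒯, ∃ s : Finset (EuclideanSpace ℝ (Fin d)),
    (s : Set (EuclideanSpace ℝ (Fin d))) ⊆ A ∧ Δ = convexHull ℝ (s : Set _)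
  full_dim : ∀ Δ ∈ 𝒯, affineSpan ℝ Δ = ⊤
  cover : ⋃₀ 𝒯 = R
  face_to_face : ∀ Δ ∈ 𝒯, ∀ Δ' ∈ 𝒯, IsExposed ℝ Δ (Δ ∩ Δ') ∧ IsExposed ℝ Δ' (Δ ∩ Δ')

/-- A triangulation is a subdivision all of whose polytopes are simplices. -/
structure IsTriangulation (A : Set (EuclideanSpace ℝ (Fin d)))
    (R : Set (EuclideanSpace ℝ (Fin d)))
    (𝒯 : Set (Set (EuclideanSpace ℝ (Fin d)))) : Prop extends IsSubdivision A R 𝒯 where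
  simplex : ∀ Δ ∈ 𝒯, ∃ s : Finset (EuclideanSpace ℝ (Fin d)),
    (s : Set (EuclideanSpace ℝ (Fin d))) ⊆ A ∧
      AffineIndependent ℝ ((↑) : s → EuclideanSpace ℝ (Fin d)) ∧ Δ = convexHull ℝ (s : Set _)

/-- The (not necessarily convex, possibly empty) polyhedral regions `E r` subdivide `R`: they cover
`R`, their interiors are pairwise disjoint, and each is a union of `d`-dimensional polytopes with
vertices in `A` in such a way that any two of all these polytopes, also when they lie in different
regions, meet in a common face. -/
structure IsRegionSubdivision (A : Set (EuclideanSpace ℝ (Fin d)))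
    (R : Set (EuclideanSpace ℝ (Fin d))) (E : ℕ → Set (EuclideanSpace ℝ (Fin d))) : Prop where
  cover : ⋃ r, E r = R
  disjoint_interior : ∀ r s, r ≠ s → Disjoint (interior (E r)) (interior (E s))
  face_to_face : ∃ 𝒯 : ℕ → Set (Set (EuclideanSpace ℝ (Fin d))),
    (∀ r, IsSubdivision A (E r) (𝒯 r)) ∧ IsSubdivision A R (⋃ r, 𝒯 r)

/-- The tiles `ℰ^(r)(Q)`: tiles `Π_{I,B}` of `P` with `|I| = r`, `B ∩ Q = ∅` and `I ⊆ Q`. -/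
def linkTiles (P : Set (Finset (Fin n) × Finset (Fin n))) (Q : Finset (Fin n)) (r : ℕ) :
    Set (Finset (Fin n) × Finset (Fin n)) :=
  {t ∈ P | t.1.card = r ∧ Disjoint t.2 Q ∧ t.1 ⊆ Q}

/-- The set of simplices `𝒯^(r)(Q) = {ch({a_b}_{b ∈ B}) : Π_{I,B} ∈ ℰ^(r)(Q)}`. -/
def linkSimplices (a : Fin n → EuclideanSpace ℝ (Fin d))
    (P : Set (Finset (Fin n) × Finset (Fin n))) (Q : Finset (Fin n)) (r : ℕ) :
    Set (Set (EuclideanSpace ℝ (Fin d))) :=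
  {Δ | ∃ t ∈ linkTiles P Q r, Δ = convexHull ℝ (a '' (t.2 : Set (Fin n)))}

/-- The region `E^(r)(Q)`, the union of the simplices `ch({a_b}_{b ∈ B})`, `Π_{I,B} ∈ ℰ^(r)(Q)`. -/
def regionE (a : Fin n → EuclideanSpace ℝ (Fin d))
    (P : Set (Finset (Fin n) × Finset (Fin n))) (Q : Finset (Fin n)) (r : ℕ) :
    Set (EuclideanSpace ℝ (Fin d)) :=
  ⋃ t ∈ linkTiles P Q r, convexHull ℝ (a '' (t.2 : Set (Fin n)))

/-- The link region `R(Q) = E^(k)(Q)`, `k = |Q|`. -/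
def linkRegion (a : Fin n → EuclideanSpace ℝ (Fin d))
    (P : Set (Finset (Fin n) × Finset (Fin n))) (Q : Finset (Fin n)) :
    Set (EuclideanSpace ℝ (Fin d)) :=
  regionE a P Q Q.card

/-- The points `{a_i}_{i ∉ Q}`. -/
def pointsOff (a : Fin n → EuclideanSpace ℝ (Fin d)) (Q : Finset (Fin n)) :
    Set (EuclideanSpace ℝ (Fin d)) :=
  a '' {i | i ∉ Q}

/-- `ch_Q(A) = ch({a_i}_{i ∉ Q})`. -/
def chQ (a : Fin n → EuclideanSpace ℝ (Fin d)) (Q : Finset (Fin n)) :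
    Set (EuclideanSpace ℝ (Fin d)) :=
  convexHull ℝ (pointsOff a Q)

end LinkTiling

end

/-! Encode a tiling by coefficient vectors: a tile `Π_{I,B}` is the image, under the linear map `L`
sending `γ` to `∑ γ i • v i`, of the cube with coordinates free in `[0, 1]` on `B`, equal to `1` on
`I` and to `0` elsewhere. Since common faces carry the same index sets in both tiles, `L` is
injective on the union of these cubes, and this union therefore parametrizes the zonotope
bijectively (`IsSectionFamily`).

The main point is that this property survives the deletion of an index `q`
(`IsSectionFamily.eraseFamily`). It rests on `segment_mem`: when a point of the zonotope moves along
`v q`, its `q`-coefficient grows at unit speed inside cubes with `q ∈ B` and is constant inside the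
others, so if its total growth equals the distance travelled, no other coefficient changes.

Delete all of `Q`. The tiles with `I ⊆ Q` and `B` disjoint from `Q` become the full-dimensional
tiles with `I` empty, those spanned at the origin. In `ℝ^d` they appear as the simplices on `B`,
whose barycentric coordinates are coefficient vectors. Injectivity of `L` makes the simplices meet
in common faces (`convexHull_inter`); surjectivity makes them cover `ch_Q(A)` up to a null set,
hence completely when `ch_Q(A)` is full-dimensional (`chQ_subset`). Finally, `B` determines the
surviving tile (`eq_of_snd_eq`), so different values of `|I|` give regions with disjoint interiors.
-/

namespace LinkTiling

/-! ### Coefficient cubes and motion along a generator -/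

section Coefficients

set_option linter.unusedSectionVars false

variable {ι W : Type*} [Fintype ι] [DecidableEq ι] [NormedAddCommGroup W] [NormedSpace ℝ W]

/-- A continuous real function on an interval that is antitone on each member of a finite cover
does not increase from the left end to the right end. -/
theorem le_of_antitoneOn_finite_cover {κ : Type*} {F : Set κ} (hF : F.Finite) (U : κ → Set ℝ)
    {g : ℝ → ℝ} {s e : ℝ} (hse : s ≤ e) (hg : ContinuousOn g (Set.Icc s e))
    (hcov : ∀ t ∈ Set.Icc s e, ∃ k ∈ F, t ∈ U k)
    (hU : ∀ k ∈ F, ∀ t ∈ Set.Icc s e, ∀ t' ∈ Set.Icc s e, t ∈ U k → t' ∈ U k → t ≤ t' →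
      g t' ≤ g t) : g e ≤ g s := by
  by_contra! hlt
  -- Every intermediate level `c` has a last time `τ c` at which it is attained, and `g` exceeds `c`
  -- afterwards.
  have last : ∀ c ∈ Set.Ioo (g s) (g e), ∃ t ∈ Set.Icc s e, g t = c ∧
      ∀ t' ∈ Set.Icc s e, g t' ≤ c → t' ≤ t := by
    intro c hc
    have hcomp : IsCompact {t ∈ Set.Icc s e | g t = c} := by
      have h := hg.preimage_isClosed_of_isClosed isClosed_Icc (isClosed_singleton (x := c))
      exact isCompact_Icc.of_isClosed_subset h Set.inter_subset_left
    have hex : ∀ t' ∈ Set.Icc s e, g t' ≤ c → ∃ t ∈ Set.Icc t' e, g t = c := by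
      intro t' ht' hle
      exact intermediate_value_Icc ht'.2 (hg.mono (Set.Icc_subset_Icc_left ht'.1))
        ⟨hle, hc.2.le⟩
    obtain ⟨t₀, ht₀, h₀⟩ := hex s ⟨le_rfl, hse⟩ hc.1.le
    obtain ⟨t, ht, hmax⟩ := hcomp.exists_isGreatest ⟨t₀, ht₀, h₀⟩
    refine ⟨t, ht.1, ht.2, fun t' ht' hle => ?_⟩
    obtain ⟨t₁, ht₁, h₁⟩ := hex t' ht' hle
    exact ht₁.1.trans (hmax ⟨⟨ht'.1.trans ht₁.1, ht₁.2⟩, h₁⟩)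
  choose! τ hτ using last
  obtain ⟨k₀, -⟩ := hcov s ⟨le_rfl, hse⟩
  have : Nonempty κ := ⟨k₀⟩
  choose! k hk using hcov
  -- Infinitely many levels but finitely many pieces: two last times share a piece. The higher level
  -- has the later one, contradicting antitonicity there.
  obtain ⟨c, hc, c', hc', hne, hkk⟩ := (Set.Ioo_infinite hlt).exists_ne_map_eq_of_mapsTo
    (f := fun c => k (τ c)) (fun c hc => (hk _ (hτ c hc).1).1) hF
  wlog hcc : c < c' generalizing c c'
  · exact this c' hc' c hc hne.symm hkk.symm (lt_of_le_of_ne (not_lt.mp hcc) hne.symm)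
  obtain ⟨h1, h2, h3⟩ := hτ c hc
  obtain ⟨h1', h2', h3'⟩ := hτ c' hc'
  have := hU _ (hk _ h1).1 _ h1 _ h1' (hk _ h1).2 (by simpa [hkk] using (hk _ h1').2)
    (h3' _ h1 (by rw [h2]; exact hcc.le))
  linarith

/-- The coefficient vectors that are arbitrary in `[0, 1]` on `B`, are `1` on the rest of `I` and
vanish elsewhere. -/
def cube (I B : Finset ι) : Set (ι → ℝ) :=
  {γ | ∀ i, (i ∈ B → γ i ∈ Set.Icc (0 : ℝ) 1) ∧ (i ∉ B → γ i = if i ∈ I then 1 else 0)}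

/-- The union of the coefficient cubes of a family of pairs of index sets. -/
def cubes (T : Set (Finset ι × Finset ι)) : Set (ι → ℝ) := ⋃ t ∈ T, cube t.1 t.2

theorem mem_cubes {T : Set (Finset ι × Finset ι)} {γ : ι → ℝ} :
    γ ∈ cubes T ↔ ∃ t ∈ T, γ ∈ cube t.1 t.2 := by simp [cubes]

theorem isCompact_cube (I B : Finset ι) : IsCompact (cube I B) := by
  have : cube I B = Set.pi Set.univ
      (fun i => if i ∈ B then Set.Icc (0 : ℝ) 1 else {if i ∈ I then 1 else 0}) := by
    ext γ
    simp only [cube, Set.mem_ofPred_eq, Set.mem_pi, Set.mem_univ, true_implies]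
    refine forall_congr' fun i => ?_
    by_cases h : i ∈ B <;> simp [h]
  rw [this]
  refine isCompact_univ_pi fun i => ?_
  split_ifs
  exacts [isCompact_Icc, isCompact_singleton, isCompact_singleton]

theorem convex_cube (I B : Finset ι) : Convex ℝ (cube I B) := by
  intro x hx y hy s t hs ht hst i
  refine ⟨fun hi => ?_, fun hi => ?_⟩
  · exact (convex_Icc (0 : ℝ) 1) ((hx i).1 hi) ((hy i).1 hi) hs ht hst
  · simp only [Pi.add_apply, Pi.smul_apply, smul_eq_mul, (hx i).2 hi, (hy i).2 hi, ← add_mul, hst,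
      one_mul]

theorem isCompact_cubes {T : Set (Finset ι × Finset ι)} : IsCompact (cubes T) :=
  (Set.toFinite T).isCompact_biUnion fun t _ => isCompact_cube t.1 t.2

/-- The coefficient vectors of `T` parametrize bijectively the zonotope of the vectors `v_i`,
`i ∈ S`. -/
structure IsSectionFamily (v : ι → W) (S : Finset ι) (T : Set (Finset ι × Finset ι)) : Prop where
  indep : ∀ t ∈ T, LinearIndepOn ℝ v (t.2 : Set ι)
  subset : ∀ t ∈ T, t.1 ⊆ S ∧ t.2 ⊆ S
  cover : Fintype.linearCombination ℝ v '' cube ∅ S ⊆ Fintype.linearCombination ℝ v '' cubes T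
  injOn : Set.InjOn (Fintype.linearCombination ℝ v) (cubes T)

theorem continuous_linearCombination (v : ι → W) :
    Continuous (Fintype.linearCombination ℝ v) :=
  LinearMap.continuous_of_finiteDimensional _

/-- Coefficient vectors with the same linear combination that agree off a linearly independent
set of indices are equal. -/
theorem eq_of_eqOn_compl {v : ι → W} {B : Finset ι} (hB : LinearIndepOn ℝ v (B : Set ι))
    {γ δ : ι → ℝ} (hout : ∀ i ∉ B, γ i = δ i)
    (h : Fintype.linearCombination ℝ v γ = Fintype.linearCombination ℝ v δ) : γ = δ := by
  have hz : ∑ i ∈ B, (γ i - δ i) • v i = 0 := by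
    rw [Finset.sum_subset (Finset.subset_univ B)
      (fun i _ hi => by rw [hout i hi, sub_self, zero_smul])]
    simp only [sub_smul, Finset.sum_sub_distrib]
    simpa [Fintype.linearCombination_apply, sub_eq_zero] using h
  rw [linearIndepOn_finset_iff] at hB
  ext i
  by_cases hi : i ∈ B
  · exact sub_eq_zero.mp (hB _ hz i hi)
  · exact hout i hi

theorem linearCombination_add_single (v : ι → W) (γ : ι → ℝ) (q : ι) (s : ℝ) :
    Fintype.linearCombination ℝ v (γ + Pi.single q s)
      = Fintype.linearCombination ℝ v γ + s • v q := by
  rw [map_add, Fintype.linearCombination_apply_single]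

namespace IsSectionFamily

variable {v : ι → W} {S : Finset ι} {T : Set (Finset ι × Finset ι)}

theorem cubes_subset (h : IsSectionFamily v S T) : cubes T ⊆ cube ∅ S := by
  intro γ hγ i
  obtain ⟨t, ht, hm⟩ := mem_cubes.mp hγ
  obtain ⟨h1, h2⟩ := h.subset t ht
  have := hm i
  by_cases hB : i ∈ t.2
  · exact ⟨fun _ => this.1 hB, fun hS => absurd (h2 hB) hS⟩
  · rw [this.2 hB]
    exact ⟨fun _ => by split_ifs <;> simp, fun hS => by simp [show i ∉ t.1 from fun hI => hS (h1 hI)]⟩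

theorem image_eq (h : IsSectionFamily v S T) :
    Fintype.linearCombination ℝ v '' cubes T = Fintype.linearCombination ℝ v '' cube ∅ S :=
  (Set.image_mono h.cubes_subset).antisymm h.cover

theorem convex_image (h : IsSectionFamily v S T) :
    Convex ℝ (Fintype.linearCombination ℝ v '' cubes T) := by
  rw [h.image_eq]
  exact (convex_cube ∅ S).linear_image _

/-- The inverse of the parametrization is continuous along segments. -/
theorem exists_path (h : IsSectionFamily v S T) {x u : W} {s : ℝ}
    (h0 : x ∈ Fintype.linearCombination ℝ v '' cubes T)
    (h1 : x + s • u ∈ Fintype.linearCombination ℝ v '' cubes T) (hs : 0 ≤ s) :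
    ∃ p : ℝ → ι → ℝ, ContinuousOn p (Set.Icc 0 s) ∧ ∀ t ∈ Set.Icc 0 s, p t ∈ cubes T ∧
      Fintype.linearCombination ℝ v (p t) = x + t • u := by
  have hseg : ∀ t : Set.Icc 0 s, x + (t : ℝ) • u ∈ Fintype.linearCombination ℝ v '' cubes T := by
    rintro ⟨t, ht0, hts⟩
    rcases hs.eq_or_lt with rfl | hs'
    · obtain rfl : t = 0 := le_antisymm hts ht0
      simpa using h0
    · have := h.convex_image h0 h1 (a := 1 - t / s) (b := t / s)
        (by rw [sub_nonneg, div_le_one hs']; exact hts) (by positivity) (by ring)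
      convert this using 1
      rw [smul_add, smul_smul, div_mul_cancel₀ _ hs'.ne', ← add_assoc, ← add_smul]
      simp
  -- A continuous bijection from a compact space to a Hausdorff space is a homeomorphism, so the
  -- section over the segment is continuous. Its extension by `0` off the interval is immaterial.
  have : CompactSpace (cubes T) := isCompact_iff_compactSpace.mp isCompact_cubes
  let e : cubes T ≃ (Fintype.linearCombination ℝ v '' cubes T) :=
    Equiv.Set.imageOfInjOn _ _ h.injOn
  have he : Continuous e :=
    ((continuous_linearCombination v).comp continuous_subtype_val).subtype_mk _
  let φ := he.homeoOfEquivCompactToT2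
  have hφ : ∀ y, Fintype.linearCombination ℝ v (φ.symm y) = y := fun y =>
    congrArg Subtype.val (φ.apply_symm_apply y)
  refine ⟨fun t => if ht : t ∈ Set.Icc 0 s then φ.symm ⟨_, hseg ⟨t, ht⟩⟩ else 0, ?_, ?_⟩
  · rw [continuousOn_iff_continuous_domRestrict]
    have : Continuous fun t : Set.Icc 0 s => ((φ.symm ⟨_, hseg t⟩ : cubes T) : ι → ℝ) := by
      fun_prop
    convert this using 2 with t
    simp [t.2.1, t.2.2]
  · intro t ht
    simp only [ht, dif_pos]
    exact ⟨Subtype.coe_prop _, hφ _⟩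

/-- If two coefficient vectors differ in the image by `s • v q`, and in the coefficient of `q` by
`s`, then the whole segment in direction `q` consists of coefficient vectors. -/
theorem segment_mem (h : IsSectionFamily v S T) {γ γ' : ι → ℝ} (hγ : γ ∈ cubes T)
    (hγ' : γ' ∈ cubes T) {q : ι} {s : ℝ} (hs : 0 ≤ s)
    (hL : Fintype.linearCombination ℝ v γ' = Fintype.linearCombination ℝ v γ + s • v q)
    (hq : γ' q = γ q + s) : ∀ t ∈ Set.Icc 0 s, γ + Pi.single q t ∈ cubes T := by
  obtain ⟨p, hpc, hp⟩ := h.exists_path (x := Fintype.linearCombination ℝ v γ) (u := v q) (s := s)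
    ⟨γ, hγ, rfl⟩ ⟨γ', hγ', hL⟩ hs
  have hp0 : p 0 = γ := h.injOn (hp 0 ⟨le_rfl, hs⟩).1 hγ (by simp [(hp 0 ⟨le_rfl, hs⟩).2])
  have hps : p s = γ' := h.injOn (hp s ⟨hs, le_rfl⟩).1 hγ' (by rw [(hp s ⟨hs, le_rfl⟩).2, hL])
  have hin : ∀ k ∈ T, q ∈ k.2 → ∀ t ∈ Set.Icc 0 s, ∀ t' ∈ Set.Icc 0 s, p t ∈ cube k.1 k.2 →
      p t' ∈ cube k.1 k.2 → p t' = p t + Pi.single q (t' - t) := by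
    intro k hk hqk t ht t' ht' hm hm'
    refine eq_of_eqOn_compl (h.indep k hk) (fun i hi => ?_) ?_
    · have hiq : i ≠ q := fun hh => hi (hh ▸ hqk)
      simp [(hm i).2 hi, (hm' i).2 hi, hiq]
    · rw [linearCombination_add_single, (hp t ht).2, (hp t' ht').2, sub_smul]
      abel
  have hout : ∀ k ∈ T, q ∉ k.2 → ∀ t t', p t ∈ cube k.1 k.2 →
      p t' ∈ cube k.1 k.2 → p t' q = p t q := by
    intro k hk hqk t t' hm hm'
    rw [(hm q).2 hqk, (hm' q).2 hqk]
  have hgc : ContinuousOn (fun t => p t q - t) (Set.Icc 0 s) :=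
    ((continuous_apply q).comp_continuousOn hpc).sub continuousOn_id
  -- The excess `p t q - t` is constant on cubes with `q` free and decreases on the others, where `p
  -- t q` is fixed.
  have hanti : ∀ t ∈ Set.Icc 0 s, ∀ t' ∈ Set.Icc 0 s, t ≤ t' → p t' q - t' ≤ p t q - t := by
    intro t ht t' ht' htt
    have hsub : Set.Icc t t' ⊆ Set.Icc 0 s := Set.Icc_subset_Icc ht.1 ht'.2
    refine le_of_antitoneOn_finite_cover (Set.toFinite T) (fun k => {t | p t ∈ cube k.1 k.2}) htt
      (hgc.mono hsub) (fun r hr => mem_cubes.mp (hp r (hsub hr)).1) ?_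
    intro k hk r hr r' hr' hm hm' hrr
    by_cases hqk : q ∈ k.2
    · rw [hin k hk hqk r (hsub hr) r' (hsub hr') hm hm']
      simp only [Pi.add_apply, Pi.single_eq_same]
      linarith
    · rw [hout k hk hqk r r' hm hm']
      linarith
  -- By `hq` the excess has the same value at both ends, so being antitone it never changes.
  have hconst : ∀ t ∈ Set.Icc 0 s, p t q - t = γ q := by
    intro t ht
    have h1 := hanti 0 ⟨le_rfl, hs⟩ t ht ht.1
    have h2 := hanti t ht s ⟨hs, le_rfl⟩ ht.2
    rw [hps, hq] at h2
    rw [hp0] at h1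
    linarith
  let m : ℝ → ι → ℝ := fun t => p t - Pi.single q t
  have hmc : ContinuousOn m (Set.Icc 0 s) :=
    hpc.sub ((continuous_single (A := fun _ : ι => ℝ) q).continuousOn)
  -- Each cube contributes at most one value of `m`: if `q` is free, by `hin`; otherwise the path
  -- meets the cube at one time at most, since there both `p t q` and `p t q - t` are constant.
  have hfin : (m '' Set.Icc 0 s).Finite := by
    have : m '' Set.Icc 0 s ⊆ ⋃ k ∈ T, m '' (Set.Icc 0 s ∩ {t | p t ∈ cube k.1 k.2}) := by
      rintro _ ⟨t, ht, rfl⟩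
      obtain ⟨k, hk, hm⟩ := mem_cubes.mp (hp t ht).1
      exact Set.mem_biUnion hk ⟨t, ⟨ht, hm⟩, rfl⟩
    refine Set.Finite.subset ((Set.toFinite T).biUnion fun k hk => Set.Subsingleton.finite ?_) this
    rintro _ ⟨t, ⟨ht, hm⟩, rfl⟩ _ ⟨t', ⟨ht', hm'⟩, rfl⟩
    by_cases hqk : q ∈ k.2
    · simp only [m]
      rw [hin k hk hqk t ht t' ht' hm hm', Pi.single_sub]
      abel
    · have h1 := hconst t ht
      have h2 := hconst t' ht'
      rw [hout k hk hqk t t' hm hm'] at h2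
      obtain rfl : t = t' := by linarith
      rfl
  have hss : (m '' Set.Icc 0 s).Subsingleton :=
    Set.not_nontrivial_iff.mp fun hnt =>
      (isPreconnected_Icc.image m hmc).infinite_of_nontrivial hnt hfin
  intro t ht
  have hmt : m t = m 0 := hss ⟨t, ht, rfl⟩ ⟨0, ⟨le_rfl, hs⟩, rfl⟩
  have : γ + Pi.single q t = p t := by
    simp only [m, hp0, Pi.single_zero, sub_zero] at hmt
    rw [← hmt]
    abel
  rw [this]
  exact (hp t ht).1

end IsSectionFamily

end Coefficients

/-! ### Deleting indices from a section family -/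

section Deletion

set_option linter.unusedSectionVars false

variable {ι W : Type*} [Fintype ι] [DecidableEq ι] [NormedAddCommGroup W] [NormedSpace ℝ W]

theorem update_zero_mem_cube {I B : Finset ι} {γ : ι → ℝ} (h : γ ∈ cube I B) (q : ι) :
    Function.update γ q 0 ∈ cube (I.erase q) (B.erase q) := by
  intro i
  by_cases hi : i = q
  · subst hi
    simp
  · simpa [hi] using h i

theorem exists_of_mem_cube_erase {I B : Finset ι} {q : ι} {γ : ι → ℝ}
    (h : γ ∈ cube (I.erase q) (B.erase q)) : ∃ δ ∈ cube I B, γ = Function.update δ q 0 := by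
  refine ⟨Function.update γ q (if q ∈ I then 1 else 0), fun i => ?_, ?_⟩
  · by_cases hi : i = q
    · subst hi
      by_cases hI : i ∈ I <;> simp [hI]
    · simpa [hi] using h i
  · have : γ q = 0 := by simpa using (h q).2
    rw [Function.update_idem, ← this, Function.update_eq_self]

theorem update_zero_eq (γ : ι → ℝ) (q : ι) :
    Function.update γ q 0 = γ + Pi.single q (-γ q) := by
  ext i
  by_cases hi : i = q
  · subst hi
    simp
  · simp [hi]

/-- Delete the index `q` from all index sets. -/
def eraseFamily (T : Set (Finset ι × Finset ι)) (q : ι) : Set (Finset ι × Finset ι) :=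
  (fun t => (t.1.erase q, t.2.erase q)) '' T

theorem cubes_eraseFamily (T : Set (Finset ι × Finset ι)) (q : ι) :
    cubes (eraseFamily T q) = (fun γ => Function.update γ q 0) '' cubes T := by
  ext γ
  constructor
  · intro h
    obtain ⟨_, ⟨t, ht, rfl⟩, hm⟩ := mem_cubes.mp h
    obtain ⟨δ, hδ, rfl⟩ := exists_of_mem_cube_erase hm
    exact ⟨δ, mem_cubes.mpr ⟨t, ht, hδ⟩, rfl⟩
  · rintro ⟨δ, hδ, rfl⟩
    obtain ⟨t, ht, hm⟩ := mem_cubes.mp hδ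
    exact mem_cubes.mpr ⟨_, ⟨t, ht, rfl⟩, update_zero_mem_cube hm q⟩

/-- Both halves follow a point moving along `v q`. For covering, some parameter `t` equals the
`q`-coefficient at that time, and removing this coefficient returns to the starting point. For
injectivity, two vectors that collide after deletion differ in the image by exactly the difference
of their `q`-coefficients times `v q`, so `segment_mem` applies. -/
theorem IsSectionFamily.eraseFamily {v : ι → W} {S : Finset ι} {T : Set (Finset ι × Finset ι)}
    (h : IsSectionFamily v S T) {q : ι} (hq : q ∈ S) :
    IsSectionFamily v (S.erase q) (eraseFamily T q) where
  indep := by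
    rintro _ ⟨t, ht, rfl⟩
    exact (h.indep t ht).mono (by simp)
  subset := by
    rintro _ ⟨t, ht, rfl⟩
    exact ⟨Finset.erase_subset_erase q (h.subset t ht).1,
      Finset.erase_subset_erase q (h.subset t ht).2⟩
  cover := by
    rintro _ ⟨β, hβ, rfl⟩
    have hβq : β q = 0 := by simpa using (hβ q).2
    have hβS : ∀ c ∈ Set.Icc (0 : ℝ) 1, β + Pi.single q c ∈ cube ∅ S := by
      intro c hc i
      by_cases hi : i = q
      · subst hi
        simpa [hβq, hq] using hc
      · simpa [hi] using hβ i
    obtain ⟨p, hpc, hp⟩ := h.exists_path (x := Fintype.linearCombination ℝ v β) (u := v q) (s := 1)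
      (h.cover ⟨β, by simpa using hβS 0 (by simp), rfl⟩)
      (h.cover ⟨_, hβS 1 (by simp), linearCombination_add_single v β q 1⟩) zero_le_one
    have h01 : ∀ t ∈ Set.Icc (0 : ℝ) 1, p t q ∈ Set.Icc (0 : ℝ) 1 := fun t ht =>
      (h.cubes_subset (hp t ht).1 q).1 hq
    have hgc : ContinuousOn (fun t => p t q - t) (Set.Icc 0 1) :=
      ((continuous_apply q).comp_continuousOn hpc).sub continuousOn_id
    -- As `p t q` stays in `[0, 1]`, the difference `p t q - t` is nonnegative at `0` and
    -- nonpositive at `1`.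
    obtain ⟨t, ht, h0⟩ := intermediate_value_Icc' zero_le_one hgc
      (show (0 : ℝ) ∈ _ from ⟨by have := (h01 1 (by simp)).2; linarith,
        by have := (h01 0 (by simp)).1; linarith⟩)
    refine ⟨Function.update (p t) q 0, ?_, ?_⟩
    · rw [cubes_eraseFamily]
      exact ⟨p t, (hp t ht).1, rfl⟩
    · rw [update_zero_eq, linearCombination_add_single, (hp t ht).2,
        show p t q = t by simpa [sub_eq_zero] using h0]
      simp
  injOn := by
    rw [cubes_eraseFamily]
    rintro _ ⟨δ, hδ, rfl⟩ _ ⟨δ', hδ', rfl⟩ hL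
    simp only at hL ⊢
    wlog hle : δ q ≤ δ' q generalizing δ δ'
    · exact (this δ' hδ' δ hδ hL.symm (le_of_not_ge hle)).symm
    have hL' : Fintype.linearCombination ℝ v δ'
        = Fintype.linearCombination ℝ v δ + (δ' q - δ q) • v q := by
      rw [update_zero_eq, update_zero_eq, linearCombination_add_single,
        linearCombination_add_single] at hL
      rw [← eq_sub_iff_add_eq] at hL
      rw [hL]
      module
    have hmem := h.segment_mem hδ hδ' (sub_nonneg.mpr hle) hL' (by ring) (δ' q - δ q)
      ⟨sub_nonneg.mpr hle, le_rfl⟩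
    have : δ' = δ + Pi.single q (δ' q - δ q) :=
      h.injOn hδ' hmem (by rw [hL', linearCombination_add_single])
    ext i
    by_cases hi : i = q
    · simp [hi]
    · rw [this]
      simp [hi]

/-- Delete all indices in `Q` from all index sets. -/
def sdiffFamily (T : Set (Finset ι × Finset ι)) (Q : Finset ι) : Set (Finset ι × Finset ι) :=
  (fun t => (t.1 \ Q, t.2 \ Q)) '' T

theorem IsSectionFamily.sdiffFamily {v : ι → W} {T : Set (Finset ι × Finset ι)}
    (h : IsSectionFamily v Finset.univ T) (Q : Finset ι) :
    IsSectionFamily v (Finset.univ \ Q) (sdiffFamily T Q) := by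
  induction Q using Finset.induction_on with
  | empty => simpa [LinkTiling.sdiffFamily] using h
  | insert q Q hq ih =>
    have := ih.eraseFamily (q := q) (by simpa using hq)
    simpa only [LinkTiling.eraseFamily, LinkTiling.sdiffFamily, Set.image_image,
      ← Finset.sdiff_insert] using this

/-- After deleting `Q`, a top-dimensional index pair comes from only one index pair. -/
theorem IsSectionFamily.eq_of_sdiff_eq {v : ι → W} {T : Set (Finset ι × Finset ι)}
    (h : IsSectionFamily v Finset.univ T) {I I' B : Finset ι}
    (hcard : ∀ t ∈ T, t.2.card ≤ B.card) (ht : (I, B) ∈ T) (ht' : (I', B) ∈ T)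
    (Q : Finset ι) (hB : Disjoint B Q) (hI : I \ Q = I' \ Q) : I = I' := by
  induction Q using Finset.induction_on with
  | empty => simpa using hI
  | insert q Q hq ih =>
    rw [Finset.disjoint_insert_right] at hB
    refine ih hB.2 ?_
    clear ih
    have hagree : ∀ i, i ≠ q → (i ∈ I \ Q ↔ i ∈ I' \ Q) := by
      intro i hi
      have := Finset.ext_iff.mp hI i
      simpa [hi] using this
    by_contra hne
    wlog hqI : q ∈ I' generalizing I I'
    · refine this ht' ht hI.symm (fun i hi => (hagree i hi).symm) (Ne.symm hne) ?_
      by_contra hqI'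
      refine hne (Finset.ext fun i => ?_)
      by_cases hi : i = q
      · subst hi
        simp [hqI, hqI']
      · exact hagree i hi
    have hqI' : q ∉ I := by
      intro hqI'
      refine hne (Finset.ext fun i => ?_)
      by_cases hi : i = q
      · subst hi
        simp [hqI, hqI']
      · exact hagree i hi
    have hS := h.sdiffFamily Q
    -- The centre of the cube of `(I \ Q, B)`. Adding `1` in coordinate `q` gives the centre of the
    -- cube of `(I' \ Q, B)`, so `segment_mem` puts their midpoint in some cube.
    let γ : ι → ℝ := fun i => if i ∈ B then 1 / 2 else if i ∈ I \ Q then 1 else 0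
    have hBQ : B \ Q = B := Finset.sdiff_eq_self_of_disjoint hB.2
    have hγ : γ ∈ cubes (LinkTiling.sdiffFamily T Q) := by
      refine mem_cubes.mpr ⟨_, ⟨_, ht, rfl⟩, fun i => ?_⟩
      simp only [hBQ, γ]
      refine ⟨fun hi => ?_, fun hi => ?_⟩
      · rw [if_pos hi]
        norm_num
      · rw [if_neg hi]
    have hγ' : γ + Pi.single q 1 ∈ cubes (LinkTiling.sdiffFamily T Q) := by
      refine mem_cubes.mpr ⟨_, ⟨_, ht', rfl⟩, fun i => ?_⟩
      simp only [hBQ, γ]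
      by_cases hi : i = q
      · subst hi
        simp [hB.1, hqI, hqI', hq]
      · refine ⟨fun hiB => ?_, fun hiB => ?_⟩
        · simp only [Pi.add_apply, if_pos hiB, Pi.single_eq_of_ne hi]
          norm_num
        · simp only [Pi.add_apply, if_neg hiB, Pi.single_eq_of_ne hi, add_zero, hagree i hi]
    have hmem := hS.segment_mem hγ hγ' zero_le_one (linearCombination_add_single v γ q 1)
      (by simp) (1 / 2) (by norm_num)
    obtain ⟨_, ⟨t, htT, rfl⟩, hm⟩ := mem_cubes.mp hmem
    -- A coefficient `1/2` can only occur at a free index, so the midpoint needs a tile with more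
    -- free indices than `hcard` permits.
    have hsub : insert q B ⊆ t.2 := by
      intro i hi
      have hhalf : (γ + Pi.single q (1 / 2) : ι → ℝ) i = 1 / 2 := by
        by_cases hiq : i = q
        · subst hiq
          simp [γ, hB.1, hqI']
        · have : i ∈ B := by simpa [hiq] using hi
          simp [γ, this, hiq]
      by_contra hcon
      have h2 := (hm i).2 (fun hh => hcon (Finset.mem_sdiff.mp hh).1)
      rw [hhalf] at h2
      split_ifs at h2 <;> norm_num at h2
    have := (Finset.card_le_card hsub).trans (hcard t htT)
    rw [Finset.card_insert_of_notMem hB.1] at this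
    omega

end Deletion

/-! ### From zonotopal tilings to section families -/

variable {d n : ℕ}

theorem linearIndepOn_lift {a : Fin n → EuclideanSpace ℝ (Fin d)} {B : Finset (Fin n)}
    (h : AffineIndependent ℝ (fun b : B => a b)) :
    LinearIndepOn ℝ (fun i => lift (a i)) (B : Set (Fin n)) := by
  rw [linearIndepOn_finset_iff]
  intro g hg i hi
  rw [← Finset.sum_coe_sort] at hg
  have h1 := congrArg Prod.fst hg
  have h2 := congrArg Prod.snd hg
  simp only [lift, Prod.fst_sum, Prod.snd_sum, Prod.smul_fst, Prod.smul_snd, smul_eq_mul, mul_one,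
    Prod.fst_zero, Prod.snd_zero] at h1 h2
  exact (affineIndependent_iff.mp h) Finset.univ (fun b => g b) h2 h1 ⟨i, hi⟩ (Finset.mem_univ _)

theorem linearCombination_lift_eq_smul_iff (a : Fin n → EuclideanSpace ℝ (Fin d)) (w : Fin n → ℝ)
    (c : ℝ) (p : EuclideanSpace ℝ (Fin d)) :
    Fintype.linearCombination ℝ (fun i => lift (a i)) w = c • lift p ↔
      ∑ i, w i • a i = c • p ∧ ∑ i, w i = c := by
  rw [Fintype.linearCombination_apply, Prod.ext_iff, Prod.fst_sum, Prod.snd_sum]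
  simp [lift]

theorem tile_eq_image (a : Fin n → EuclideanSpace ℝ (Fin d)) {I B : Finset (Fin n)}
    (h : Disjoint I B) :
    tile a I B = Fintype.linearCombination ℝ (fun i => lift (a i)) '' cube I B := by
  ext x
  constructor
  · rintro ⟨α, hα, rfl⟩
    refine ⟨fun i => if i ∈ B then α i else if i ∈ I then 1 else 0, fun i => ?_, ?_⟩
    · refine ⟨fun hi => ?_, fun hi => ?_⟩
      · simpa [hi] using hα i hi
      · simp [hi]
    · rw [Fintype.linearCombination_apply, ← Finset.sum_subset (Finset.subset_univ (I ∪ B)),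
        Finset.sum_union h]
      · congr 1
        · refine Finset.sum_congr rfl fun i hi => ?_
          rw [if_neg (Finset.disjoint_left.mp h hi), if_pos hi, one_smul]
        · exact Finset.sum_congr rfl fun i hi => by rw [if_pos hi]
      · intro i _ hi
        rw [Finset.mem_union, not_or] at hi
        simp [hi.1, hi.2]
  · rintro ⟨γ, hγ, rfl⟩
    refine ⟨γ, fun b hb => (hγ b).1 hb, ?_⟩
    rw [Fintype.linearCombination_apply, ← Finset.sum_subset (Finset.subset_univ (I ∪ B)),
        Finset.sum_union h]
    · congr 1
      refine Finset.sum_congr rfl fun i hi => ?_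
      rw [(hγ i).2 (Finset.disjoint_left.mp h hi), if_pos hi, one_smul]
    · intro i _ hi
      rw [Finset.mem_union, not_or] at hi
      simp [(hγ i).2 hi.2, hi.1]

theorem zonotope_eq_image (a : Fin n → EuclideanSpace ℝ (Fin d)) :
    zonotope a = Fintype.linearCombination ℝ (fun i => lift (a i)) '' cube ∅ Finset.univ := by
  ext x
  constructor
  · rintro ⟨α, hα, rfl⟩
    exact ⟨α, fun i => ⟨fun _ => hα i, fun hi => absurd (Finset.mem_univ i) hi⟩, rfl⟩
  · rintro ⟨γ, hγ, rfl⟩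
    exact ⟨γ, fun i => (hγ i).1 (Finset.mem_univ i), rfl⟩

theorem cube_subset_of_isTileFace {J C I B : Finset (Fin n)} (h : IsTileFace J C I B) : cube J C ⊆ cube I B := by
  intro γ hγ i
  obtain ⟨h1, h2, h3, h4⟩ := h
  by_cases hC : i ∈ C
  · exact ⟨fun _ => (hγ i).1 hC, fun hB => absurd (h1 hC) hB⟩
  · rw [(hγ i).2 hC]
    refine ⟨fun _ => by split_ifs <;> simp, fun hB => ?_⟩
    have : i ∈ J ↔ i ∈ I :=
      ⟨fun hJ => (Finset.mem_union.mp (h3 hJ)).resolve_right hB, fun hI => h2 hI⟩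
    simp [this]

namespace IsFineZonotopalTiling

variable {a : Fin n → EuclideanSpace ℝ (Fin d)} {P : Set (Finset (Fin n) × Finset (Fin n))}

theorem isSectionFamily (hP : IsFineZonotopalTiling a P) :
    IsSectionFamily (fun i => lift (a i)) Finset.univ P where
  indep t ht := linearIndepOn_lift (hP.affineIndependent t ht)
  subset t _ := ⟨Finset.subset_univ _, Finset.subset_univ _⟩
  cover := by
    rw [← zonotope_eq_image, ← hP.cover]
    refine Set.iUnion₂_subset fun t ht => ?_
    rw [tile_eq_image a (hP.disjoint t ht)]
    exact Set.image_mono fun γ hγ => mem_cubes.mpr ⟨t, ht, hγ⟩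
  injOn := by
    intro γ hγ γ' hγ' hL
    obtain ⟨t, ht, hm⟩ := mem_cubes.mp hγ
    obtain ⟨t', ht', hm'⟩ := mem_cubes.mp hγ'
    have hx : Fintype.linearCombination ℝ (fun i => lift (a i)) γ
        ∈ tile a t.1 t.2 ∩ tile a t'.1 t'.2 := by
      rw [tile_eq_image a (hP.disjoint t ht), tile_eq_image a (hP.disjoint t' ht')]
      exact ⟨⟨γ, hm, rfl⟩, ⟨γ', hm', hL.symm⟩⟩
    obtain hemp | ⟨J, C, hf, hf', heq⟩ := hP.face_to_face t ht t' ht'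
    · rw [hemp] at hx
      exact hx.elim
    · rw [heq, tile_eq_image a hf.2.2.2] at hx
      -- The common face has the same index sets in both tiles, so one vector `δ` lies in both
      -- cubes; independence within each tile identifies `γ` and `γ'` with it.
      obtain ⟨δ, hδ, hδL⟩ := hx
      have hd := cube_subset_of_isTileFace hf hδ
      have hd' := cube_subset_of_isTileFace hf' hδ
      have e1 : γ = δ := eq_of_eqOn_compl (linearIndepOn_lift (hP.affineIndependent t ht))
        (fun i hi => by rw [(hm i).2 hi, (hd i).2 hi]) hδL.symm
      have e2 : γ' = δ := eq_of_eqOn_compl (linearIndepOn_lift (hP.affineIndependent t' ht'))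
        (fun i hi => by rw [(hm' i).2 hi, (hd' i).2 hi]) (hL.symm.trans hδL.symm)
      rw [e1, e2]

end IsFineZonotopalTiling

/-! ### Simplices: barycentric coordinates, exposed faces, volume -/

/-- Barycentric coordinates of a point in the convex hull of a finite family. -/
theorem mem_convexHull_image_iff (a : Fin n → EuclideanSpace ℝ (Fin d)) (B : Finset (Fin n))
    (p : EuclideanSpace ℝ (Fin d)) :
    p ∈ convexHull ℝ (a '' (B : Set (Fin n))) ↔ ∃ w : Fin n → ℝ, (∀ i, 0 ≤ w i) ∧
      (∀ i ∉ B, w i = 0) ∧ Fintype.linearCombination ℝ (fun i => lift (a i)) w = lift p := by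
  have hL : ∀ (w : Fin n → ℝ) (p : EuclideanSpace ℝ (Fin d)),
      Fintype.linearCombination ℝ (fun i => lift (a i)) w = lift p ↔
        ∑ i, w i • a i = p ∧ ∑ i, w i = 1 := fun w p => by
    simpa using linearCombination_lift_eq_smul_iff a w 1 p
  simp only [hL]
  constructor
  · intro hp
    have hsub : convexHull ℝ (a '' (B : Set (Fin n))) ⊆ {p | ∃ w : Fin n → ℝ, (∀ i, 0 ≤ w i) ∧
        (∀ i ∉ B, w i = 0) ∧ ∑ i, w i • a i = p ∧ ∑ i, w i = 1} := by
      refine convexHull_min ?_ ?_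
      · rintro _ ⟨i, hi, rfl⟩
        refine ⟨Pi.single i 1, fun j => ?_, fun j hj => ?_, ?_, ?_⟩
        · by_cases h : j = i
          · subst h
            simp
          · simp [h]
        · exact Pi.single_eq_of_ne (by rintro rfl; exact hj hi) _
        · simp [Pi.single_apply, ite_smul]
        · simp [Pi.single_apply]
      · rintro _ ⟨w, hw, hwB, rfl, hw1⟩ _ ⟨w', hw', hwB', rfl, hw1'⟩ s t hs ht hst
        refine ⟨s • w + t • w', fun i => ?_, fun i hi => ?_, ?_, ?_⟩
        · have := mul_nonneg hs (hw i)
          have := mul_nonneg ht (hw' i)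
          simp only [Pi.add_apply, Pi.smul_apply, smul_eq_mul]
          linarith
        · simp [hwB i hi, hwB' i hi]
        · simp [add_smul, mul_smul, Finset.sum_add_distrib, Finset.smul_sum]
        · simp [Finset.sum_add_distrib, ← Finset.mul_sum, hw1, hw1', hst]
    exact hsub hp
  · rintro ⟨w, hw, hwB, rfl, hw1⟩
    rw [← Finset.sum_subset (Finset.subset_univ B) fun i _ hi => hwB i hi] at hw1
    rw [← Finset.sum_subset (Finset.subset_univ B) fun i _ hi => by rw [hwB i hi, zero_smul]]
    exact (convex_convexHull ℝ _).sum_mem (fun i _ => hw i) hw1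
      fun i hi => subset_convexHull ℝ _ ⟨i, hi, rfl⟩

/-- A face of a simplex is exposed. -/
theorem isExposed_convexHull_image {a : Fin n → EuclideanSpace ℝ (Fin d)} {B C : Finset (Fin n)}
    (hB : AffineIndependent ℝ (fun b : B => a b)) (hC : C ⊆ B) :
    IsExposed ℝ (convexHull ℝ (a '' (B : Set (Fin n)))) (convexHull ℝ (a '' (C : Set (Fin n)))) := by
  intro hne
  have hli : LinearIndependent ℝ (fun b : B => lift (a b)) := linearIndepOn_lift hB
  -- On the simplex this functional, evaluated at the lift, is the total barycentric weight carried
  -- by `C`. It is at most `1`, with equality exactly on the face spanned by `C`.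
  let f := (Module.Basis.span hli).constr ℝ (fun b => if (b : Fin n) ∈ C then (1 : ℝ) else 0)
  obtain ⟨g, hg⟩ := f.exists_extend
  have hgb : ∀ b ∈ B, g (lift (a b)) = if b ∈ C then 1 else 0 := by
    intro b hb
    have h1 := LinearMap.congr_fun hg (Module.Basis.span hli ⟨b, hb⟩)
    rw [Module.Basis.constr_basis] at h1
    simpa [Module.Basis.span_apply] using h1
  have hgw : ∀ (w : Fin n → ℝ) p, (∀ i ∉ B, w i = 0) →
      Fintype.linearCombination ℝ (fun i => lift (a i)) w = lift p → g (lift p) = ∑ i ∈ C, w i := by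
    intro w p hw hp
    rw [← hp, Fintype.linearCombination_apply, map_sum, ← Finset.sum_subset (Finset.subset_univ C)]
    · refine Finset.sum_congr rfl fun i hi => ?_
      rw [map_smul, hgb i (hC hi), if_pos hi, smul_eq_mul, mul_one]
    · intro i _ hi
      rw [map_smul]
      by_cases hiB : i ∈ B
      · rw [hgb i hiB, if_neg hi, smul_zero]
      · rw [hw i hiB, zero_smul]
  have hsum : ∀ (w : Fin n → ℝ) p,
      Fintype.linearCombination ℝ (fun i => lift (a i)) w = lift p → ∑ i, w i = 1 := fun w p hp =>
    ((linearCombination_lift_eq_smul_iff a w 1 p).mp (by rw [hp, one_smul])).2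
  -- The function `p ↦ g (p, 1)` is affine; dropping the constant `g (0, 1)` leaves a linear
  -- functional with the same maximizers.
  let l : StrongDual ℝ (EuclideanSpace ℝ (Fin d)) :=
    LinearMap.toContinuousLinearMap (g ∘ₗ LinearMap.inl ℝ _ _)
  have hl : ∀ p, l p = g (lift p) - g (0, 1) := fun p => by
    rw [← map_sub]
    simp [l, lift]
  refine ⟨l, ?_⟩
  simp only [hl, sub_le_sub_iff_right]
  ext p
  constructor
  · intro hp
    refine ⟨convexHull_mono (Set.image_mono (by exact_mod_cast hC)) hp, fun y hy => ?_⟩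
    obtain ⟨w, hw, hwC, hwp⟩ := (mem_convexHull_image_iff a C p).mp hp
    obtain ⟨w', hw', hwB', hwp'⟩ := (mem_convexHull_image_iff a B y).mp hy
    rw [hgw w p (fun i hi => hwC i fun h => hi (hC h)) hwp, hgw w' y hwB' hwp',
      Finset.sum_subset (Finset.subset_univ C) fun i _ hi => hwC i hi, hsum w p hwp,
      ← hsum w' y hwp']
    exact Finset.sum_le_univ_sum_of_nonneg hw'
  · rintro ⟨hp, hmax⟩
    obtain ⟨w, hw, hwB, hwp⟩ := (mem_convexHull_image_iff a B p).mp hp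
    obtain ⟨_, c, hc, rfl⟩ := convexHull_nonempty_iff.mp hne
    have h1 := hmax (a c) (subset_convexHull ℝ _ ⟨c, hC hc, rfl⟩)
    rw [hgb c (hC hc), if_pos (Finset.mem_coe.mp hc), hgw w p hwB hwp, ← hsum w p hwp, ← Finset.sum_add_sum_compl C,
      add_le_iff_nonpos_right] at h1
    refine (mem_convexHull_image_iff a C p).mpr ⟨w, hw, fun i hi => ?_, hwp⟩
    have h2 := (Finset.single_le_sum (f := w) (fun j _ => hw j) (Finset.mem_compl.mpr hi)).trans h1
    exact le_antisymm h2 (hw i)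

theorem volume_convexHull_image_eq_zero (a : Fin n → EuclideanSpace ℝ (Fin d))
    {C : Finset (Fin n)} (hC : C.card ≤ d) :
    MeasureTheory.volume (convexHull ℝ (a '' (C : Set (Fin n)))) = 0 := by
  refine MeasureTheory.measure_mono_null (convexHull_subset_affineSpan _)
    (MeasureTheory.Measure.addHaar_affineSubspace _ _ fun htop => ?_)
  rcases C.eq_empty_or_nonempty with rfl | hne
  · simp at htop
  · obtain ⟨m, hm⟩ := Nat.exists_eq_add_one_of_ne_zero hne.card_pos.ne'
    have h1 := finrank_vectorSpan_image_finset_le ℝ a C hm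
    rw [Finset.coe_image, ← direction_affineSpan, htop, AffineSubspace.direction_top, finrank_top,
      finrank_euclideanSpace_fin] at h1
    omega

theorem isCompact_convexHull_image (a : Fin n → EuclideanSpace ℝ (Fin d)) (C : Finset (Fin n)) :
    IsCompact (convexHull ℝ (a '' (C : Set (Fin n)))) :=
  (C.finite_toSet.image a).isCompact_convexHull ℝ

/-! ### Simplices that survive the deletion of `Q` -/

namespace IsFineZonotopalTiling

variable {a : Fin n → EuclideanSpace ℝ (Fin d)} {P : Set (Finset (Fin n) × Finset (Fin n))}
  {Q : Finset (Fin n)}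

/-- The tiles that contribute a simplex after deleting `Q`: the union of the `linkTiles P Q r`. -/
theorem mem_linkTiles {t : Finset (Fin n) × Finset (Fin n)} {r : ℕ} :
    t ∈ linkTiles P Q r ↔ (t ∈ P ∧ Disjoint t.2 Q ∧ t.1 ⊆ Q) ∧ t.1.card = r := by
  simp only [linkTiles, Set.mem_ofPred_eq]
  tauto

/-- Barycentric coordinates in either simplex are coefficient vectors of the tiling with `Q`
deleted. Injectivity makes the two coordinate vectors of a common point equal, hence supported on
both vertex sets. -/
theorem convexHull_inter (hP : IsFineZonotopalTiling a P) {t t' : Finset (Fin n) × Finset (Fin n)}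
    (ht : t ∈ P ∧ Disjoint t.2 Q ∧ t.1 ⊆ Q) (ht' : t' ∈ P ∧ Disjoint t'.2 Q ∧ t'.1 ⊆ Q) :
    convexHull ℝ (a '' (t.2 : Set (Fin n))) ∩ convexHull ℝ (a '' (t'.2 : Set (Fin n)))
      = convexHull ℝ (a '' ((t.2 ∩ t'.2 : Finset (Fin n)) : Set (Fin n))) := by
  have hmem : ∀ u : Finset (Fin n) × Finset (Fin n), (u ∈ P ∧ Disjoint u.2 Q ∧ u.1 ⊆ Q) →
      ∀ (w : Fin n → ℝ) (p : EuclideanSpace ℝ (Fin d)), (∀ i, 0 ≤ w i) → (∀ i ∉ u.2, w i = 0) →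
        Fintype.linearCombination ℝ (fun i => lift (a i)) w = lift p →
          w ∈ cubes (sdiffFamily P Q) := by
    intro u hu w p hw hwB hp
    have hs := ((linearCombination_lift_eq_smul_iff a w 1 p).mp (by rw [hp, one_smul])).2
    refine mem_cubes.mpr ⟨_, ⟨u, hu.1, rfl⟩, fun i => ?_⟩
    simp only [Finset.sdiff_eq_self_of_disjoint hu.2.1,
      Finset.sdiff_eq_empty_iff_subset.mpr hu.2.2]
    refine ⟨fun _ => ⟨hw i, ?_⟩, fun hi => by simpa using hwB i hi⟩
    rw [← hs]
    exact Finset.single_le_sum (fun j _ => hw j) (Finset.mem_univ i)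
  refine Set.Subset.antisymm ?_ (Set.subset_inter ?_ ?_)
  · rintro p ⟨hp, hp'⟩
    obtain ⟨w, hw, hwB, hwp⟩ := (mem_convexHull_image_iff a _ p).mp hp
    obtain ⟨w', hw', hwB', hwp'⟩ := (mem_convexHull_image_iff a _ p).mp hp'
    have heq : w = w' := (hP.isSectionFamily.sdiffFamily Q).injOn (hmem t ht w p hw hwB hwp)
      (hmem t' ht' w' p hw' hwB' hwp') (hwp.trans hwp'.symm)
    refine (mem_convexHull_image_iff a _ p).mpr ⟨w, hw, fun i hi => ?_, hwp⟩
    by_cases hit : i ∈ t.2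
    · rw [heq]
      exact hwB' i fun h => hi (Finset.mem_inter.mpr ⟨hit, h⟩)
    · exact hwB i hit
  · exact convexHull_mono (Set.image_mono (by exact_mod_cast Finset.inter_subset_left))
  · exact convexHull_mono (Set.image_mono (by exact_mod_cast Finset.inter_subset_right))

/-- This excludes one simplex arising from tiles with different `|I|`. Both first index sets become
empty after deletion, and all second index sets have the same size. -/
theorem eq_of_snd_eq (hP : IsFineZonotopalTiling a P) {t t' : Finset (Fin n) × Finset (Fin n)}
    (ht : t ∈ P ∧ Disjoint t.2 Q ∧ t.1 ⊆ Q) (ht' : t' ∈ P ∧ Disjoint t'.2 Q ∧ t'.1 ⊆ Q)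
    (h : t.2 = t'.2) : t = t' := by
  refine Prod.ext ?_ h
  obtain ⟨I, B⟩ := t
  obtain ⟨I', B'⟩ := t'
  obtain rfl : B = B' := h
  refine hP.isSectionFamily.eq_of_sdiff_eq (fun t ht0 => ?_) ht.1 ht'.1 Q ht.2.1 ?_
  · rw [hP.card_eq t ht0, ← hP.card_eq _ ht.1]
  · rw [Finset.sdiff_eq_empty_iff_subset.mpr ht.2.2, Finset.sdiff_eq_empty_iff_subset.mpr ht'.2.2]

/-- Every point of `ch_Q(A)` lies in the possibly lower-dimensional simplex of a tile `Π_{I,B}`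
with `I ⊆ Q`, from which the vertices in `Q` have been deleted. -/
theorem exists_mem_convexHull_sdiff (hP : IsFineZonotopalTiling a P)
    {p : EuclideanSpace ℝ (Fin d)} (hp : p ∈ chQ a Q) :
    ∃ t ∈ P, t.1 ⊆ Q ∧ p ∈ convexHull ℝ (a '' ((t.2 \ Q : Finset (Fin n)) : Set (Fin n))) := by
  have hcoe : ((Finset.univ \ Q : Finset (Fin n)) : Set (Fin n)) = {i | i ∉ Q} := by
    ext i
    simp
  rw [chQ, pointsOff, ← hcoe, mem_convexHull_image_iff] at hp
  obtain ⟨w, hw, hwQ, hwp⟩ := hp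
  have hs := ((linearCombination_lift_eq_smul_iff a w 1 p).mp (by rw [hwp, one_smul])).2
  -- Scaling to height `1/2` makes all coefficients sum to `1/2`, so none can be `1`; this forces
  -- the covering tile to satisfy `I ⊆ Q`.
  have hcube : (1 / 2 : ℝ) • w ∈ cube ∅ (Finset.univ \ Q) := by
    intro i
    have hle : w i ≤ 1 := by
      rw [← hs]
      exact Finset.single_le_sum (fun j _ => hw j) (Finset.mem_univ i)
    have := hw i
    refine ⟨fun _ => ?_, fun hi => by simp [hwQ i hi]⟩
    simp only [Pi.smul_apply, smul_eq_mul, Set.mem_Icc]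
    constructor <;> linarith
  obtain ⟨δ, hδ, hδL⟩ := (hP.isSectionFamily.sdiffFamily Q).cover ⟨_, hcube, rfl⟩
  rw [map_smul, hwp] at hδL
  have hδs := ((linearCombination_lift_eq_smul_iff a δ _ p).mp hδL).2
  have hδ0 : ∀ i, 0 ≤ δ i := by
    intro i
    have := (hP.isSectionFamily.sdiffFamily Q).cubes_subset hδ i
    by_cases hi : i ∈ Finset.univ \ Q
    · exact (this.1 hi).1
    · simp [this.2 hi]
  obtain ⟨_, ⟨t, ht, rfl⟩, hm⟩ := mem_cubes.mp hδ
  have htQ : t.1 ⊆ Q := by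
    intro i hi
    by_contra hiQ
    have hiB : i ∉ t.2 := Finset.disjoint_left.mp (hP.disjoint t ht) hi
    have h1 : δ i = 1 := by simpa [hi, hiQ] using (hm i).2 (by simp [hiB])
    have h2 := Finset.single_le_sum (f := δ) (fun j _ => hδ0 j) (Finset.mem_univ i)
    rw [hδs, h1] at h2
    norm_num at h2
  refine ⟨t, ht, htQ, (mem_convexHull_image_iff a _ p).mpr
    ⟨(2 : ℝ) • δ, fun i => mul_nonneg zero_le_two (hδ0 i), fun i hi => ?_, ?_⟩⟩
  · have := (hm i).2 hi
    simp only [Finset.sdiff_eq_empty_iff_subset.mpr htQ, Finset.notMem_empty, if_false] at this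
    simp [this]
  · rw [map_smul, hδL, smul_smul]
    norm_num

/-- Points covered only by tiles with `B` meeting `Q` lie in simplices with at most `d` vertices, a
null set. The remaining simplices form a closed set, so it contains the interior of `ch_Q(A)`, and
by the spanning condition also its closure. -/
theorem chQ_subset (hP : IsFineZonotopalTiling a P)
    (h : Q = Finset.univ ∨ affineSpan ℝ (pointsOff a Q) = ⊤) :
    chQ a Q ⊆ ⋃ r, regionE a P Q r := by
  rcases h with rfl | hspan
  · simp [chQ, pointsOff]
  have hF : ⋃ r, regionE a P Q r = ⋃ t ∈ {t | t ∈ P ∧ Disjoint t.2 Q ∧ t.1 ⊆ Q},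
      convexHull ℝ (a '' (t.2 : Set (Fin n))) := by
    ext x
    simp only [regionE, mem_linkTiles, Set.mem_iUnion, Set.mem_ofPred_eq, exists_prop]
    constructor
    · rintro ⟨_, t, ⟨ht, -⟩, hx⟩
      exact ⟨t, ht, hx⟩
    · rintro ⟨t, ht, hx⟩
      exact ⟨_, t, ⟨ht, rfl⟩, hx⟩
  have hclosed : IsClosed (⋃ r, regionE a P Q r) := by
    rw [hF]
    exact (Set.toFinite _).isClosed_biUnion fun t _ => (isCompact_convexHull_image a t.2).isClosed
  have hnull : MeasureTheory.volume (⋃ t ∈ {t | t ∈ P ∧ ¬ Disjoint t.2 Q},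
      convexHull ℝ (a '' ((t.2 \ Q : Finset (Fin n)) : Set (Fin n)))) = 0 := by
    refine (MeasureTheory.measure_biUnion_null_iff (Set.to_countable _)).mpr fun t ht =>
      volume_convexHull_image_eq_zero a ?_
    have : t.2 \ Q ⊂ t.2 := by
      refine Finset.sdiff_subset.ssubset_of_ne fun heq => ht.2 ?_
      rw [← heq]
      exact Finset.sdiff_disjoint
    have := Finset.card_lt_card this
    rw [hP.card_eq t ht.1] at this
    omega
  have hempty : interior (chQ a Q) \ ⋃ r, regionE a P Q r = ∅ := by
    refine (isOpen_interior.sdiff hclosed).eq_empty_of_measure_zero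
      (μ := MeasureTheory.volume) (MeasureTheory.measure_mono_null ?_ hnull)
    rintro p ⟨hp, hpF⟩
    obtain ⟨t, ht, htQ, hpt⟩ := hP.exists_mem_convexHull_sdiff (interior_subset hp)
    refine Set.mem_biUnion (x := t) ⟨ht, fun hdis => hpF ?_⟩ hpt
    rw [Finset.sdiff_eq_self_of_disjoint hdis] at hpt
    rw [hF]
    exact Set.mem_biUnion (x := t) ⟨ht, hdis, htQ⟩ hpt
  calc chQ a Q ⊆ closure (chQ a Q) := subset_closure
    _ = closure (interior (chQ a Q)) :=
      ((convex_convexHull ℝ _).closure_interior_eq_closure_of_nonempty_interior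
        (interior_convexHull_nonempty_iff_affineSpan_eq_top.mpr hspan)).symm
    _ ⊆ ⋃ r, regionE a P Q r := closure_minimal (Set.sdiff_eq_empty.mp hempty) hclosed

/-- A family of simplices of tiles that survive the deletion of `Q` triangulates its union. -/
theorem isTriangulation (hP : IsFineZonotopalTiling a P)
    (𝒯 : Set (Set (EuclideanSpace ℝ (Fin d)))) (h𝒯 : 𝒯 ⊆ ⋃ r, linkSimplices a P Q r) :
    IsTriangulation (pointsOff a Q) (⋃₀ 𝒯) 𝒯 := by
  classical
  have hex : ∀ Δ ∈ 𝒯, ∃ t, (t ∈ P ∧ Disjoint t.2 Q ∧ t.1 ⊆ Q) ∧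
      Δ = convexHull ℝ (a '' (t.2 : Set (Fin n))) := by
    intro Δ hΔ
    obtain ⟨r, t, ht, rfl⟩ := Set.mem_iUnion.mp (h𝒯 hΔ)
    exact ⟨t, (mem_linkTiles.mp ht).1, rfl⟩
  have hsub : ∀ t : Finset (Fin n) × Finset (Fin n), Disjoint t.2 Q →
      ((t.2.image a : Finset _) : Set (EuclideanSpace ℝ (Fin d))) ⊆ pointsOff a Q := by
    intro t ht
    rw [Finset.coe_image]
    exact Set.image_mono fun i hi => Finset.disjoint_left.mp ht hi
  have hrange : ∀ B : Finset (Fin n), Set.range (fun b : B => a b) = a '' (B : Set (Fin n)) := by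
    intro B
    ext x
    simp
  refine ⟨⟨fun Δ hΔ => ?_, fun Δ hΔ => ?_, rfl, fun Δ hΔ Δ' hΔ' => ?_⟩, fun Δ hΔ => ?_⟩
  · obtain ⟨t, ht, rfl⟩ := hex Δ hΔ
    exact ⟨t.2.image a, hsub t ht.2.1, by rw [Finset.coe_image]⟩
  · obtain ⟨t, ht, rfl⟩ := hex Δ hΔ
    rw [affineSpan_convexHull, ← hrange,
      (hP.affineIndependent t ht.1).affineSpan_eq_top_iff_card_eq_finrank_add_one]
    simp [hP.card_eq t ht.1]
  · obtain ⟨t, ht, rfl⟩ := hex Δ hΔ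
    obtain ⟨t', ht', rfl⟩ := hex Δ' hΔ'
    rw [hP.convexHull_inter ht ht']
    exact ⟨isExposed_convexHull_image (hP.affineIndependent t ht.1) Finset.inter_subset_left,
      isExposed_convexHull_image (hP.affineIndependent t' ht'.1) Finset.inter_subset_right⟩
  · obtain ⟨t, ht, rfl⟩ := hex Δ hΔ
    refine ⟨t.2.image a, hsub t ht.2.1, ?_, by rw [Finset.coe_image]⟩
    refine (hP.affineIndependent t ht.1).range.mono ?_
    rw [hrange, Finset.coe_image]

end IsFineZonotopalTiling

/-! ### The regions and their interiors -/

theorem regionE_eq_sUnion (a : Fin n → EuclideanSpace ℝ (Fin d))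
    (P : Set (Finset (Fin n) × Finset (Fin n))) (Q : Finset (Fin n)) (r : ℕ) :
    regionE a P Q r = ⋃₀ linkSimplices a P Q r := by
  ext x
  simp only [regionE, linkSimplices, Set.mem_iUnion, Set.mem_sUnion, Set.mem_ofPred_eq]
  constructor
  · rintro ⟨t, ht, hx⟩
    exact ⟨_, ⟨t, ht, rfl⟩, hx⟩
  · rintro ⟨_, ⟨t, ht, rfl⟩, hx⟩
    exact ⟨t, ht, hx⟩

theorem iUnion_regionE (a : Fin n → EuclideanSpace ℝ (Fin d))
    (P : Set (Finset (Fin n) × Finset (Fin n))) (Q : Finset (Fin n)) :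
    ⋃ r, regionE a P Q r = ⋃₀ ⋃ r, linkSimplices a P Q r := by
  simp only [regionE_eq_sUnion, Set.sUnion_iUnion]

namespace IsFineZonotopalTiling

variable {a : Fin n → EuclideanSpace ℝ (Fin d)} {P : Set (Finset (Fin n) × Finset (Fin n))}
  {Q : Finset (Fin n)}

theorem isTriangulation_regionE (hP : IsFineZonotopalTiling a P) (Q : Finset (Fin n)) (r : ℕ) :
    IsTriangulation (pointsOff a Q) (regionE a P Q r) (linkSimplices a P Q r) := by
  rw [regionE_eq_sUnion]
  exact hP.isTriangulation _ (Set.subset_iUnion _ r)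

theorem convexHull_subset_chQ {B : Finset (Fin n)} (hB : Disjoint B Q) :
    convexHull ℝ (a '' (B : Set (Fin n))) ⊆ chQ a Q :=
  convexHull_mono (Set.image_mono fun _ hi => Finset.disjoint_left.mp hB hi)

theorem iUnion_regionE_eq_chQ (hP : IsFineZonotopalTiling a P)
    (h : Q = Finset.univ ∨ affineSpan ℝ (pointsOff a Q) = ⊤) :
    ⋃ r, regionE a P Q r = chQ a Q := by
  refine Set.Subset.antisymm (Set.iUnion_subset fun r => ?_) (hP.chQ_subset h)
  exact Set.iUnion₂_subset fun t ht => convexHull_subset_chQ (mem_linkTiles.mp ht).1.2.1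

theorem isTriangulation_chQ (hP : IsFineZonotopalTiling a P)
    (h : Q = Finset.univ ∨ affineSpan ℝ (pointsOff a Q) = ⊤) :
    IsTriangulation (pointsOff a Q) (chQ a Q) (⋃ r, linkSimplices a P Q r) := by
  rw [← hP.iUnion_regionE_eq_chQ h, iUnion_regionE]
  exact hP.isTriangulation _ subset_rfl

/-- Simplices from different regions have different vertex index sets by `eq_of_snd_eq`, so they
share at most `d` indices and meet in a null set. The intersection of the interiors is thus open and
null. -/
theorem disjoint_interior_regionE (hP : IsFineZonotopalTiling a P) (Q : Finset (Fin n))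
    {r s : ℕ} (hrs : r ≠ s) :
    Disjoint (interior (regionE a P Q r)) (interior (regionE a P Q s)) := by
  rw [Set.disjoint_iff_inter_eq_empty]
  have hnull : MeasureTheory.volume (⋃ t ∈ linkTiles P Q r, ⋃ t' ∈ linkTiles P Q s,
      convexHull ℝ (a '' (t.2 : Set (Fin n))) ∩ convexHull ℝ (a '' (t'.2 : Set (Fin n)))) = 0 := by
    refine (MeasureTheory.measure_biUnion_null_iff (Set.to_countable _)).mpr fun t ht =>
      (MeasureTheory.measure_biUnion_null_iff (Set.to_countable _)).mpr fun t' ht' => ?_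
    rw [mem_linkTiles] at ht ht'
    rw [hP.convexHull_inter ht.1 ht'.1]
    refine volume_convexHull_image_eq_zero a ?_
    by_contra! hlt
    have h1 : t.2 ∩ t'.2 = t.2 := Finset.eq_of_subset_of_card_le Finset.inter_subset_left
      (by rw [hP.card_eq t ht.1.1]; exact hlt)
    have h2 : t.2 ∩ t'.2 = t'.2 := Finset.eq_of_subset_of_card_le Finset.inter_subset_right
      (by rw [hP.card_eq t' ht'.1.1]; exact hlt)
    apply hrs
    rw [← ht.2, ← ht'.2, hP.eq_of_snd_eq ht.1 ht'.1 (h1.symm.trans h2)]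
  refine (isOpen_interior.inter isOpen_interior).eq_empty_of_measure_zero
    (μ := MeasureTheory.volume) (MeasureTheory.measure_mono_null ?_ hnull)
  rintro p ⟨hp, hp'⟩
  obtain ⟨t, ht, hpt⟩ := Set.mem_iUnion₂.mp (interior_subset hp)
  obtain ⟨t', ht', hpt'⟩ := Set.mem_iUnion₂.mp (interior_subset hp')
  exact Set.mem_biUnion ht (Set.mem_biUnion ht' ⟨hpt, hpt'⟩)

end IsFineZonotopalTiling

end LinkTiling

theorem proposition3 {d n : ℕ} (a : Fin n → EuclideanSpace ℝ (Fin d))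
    (ha : affineSpan ℝ (Set.range a) = ⊤)
    (P : Set (Finset (Fin n) × Finset (Fin n)))
    (hP : LinkTiling.IsFineZonotopalTiling a P)
    (Q : Finset (Fin n)) :
    (∀ r : ℕ, LinkTiling.IsTriangulation (LinkTiling.pointsOff a Q)
      (LinkTiling.regionE a P Q r) (LinkTiling.linkSimplices a P Q r)) ∧
    ((Q = Finset.univ ∨ affineSpan ℝ (LinkTiling.pointsOff a Q) = ⊤) →
      LinkTiling.IsRegionSubdivision (LinkTiling.pointsOff a Q)
        (LinkTiling.chQ a Q) (fun r => LinkTiling.regionE a P Q r) ∧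
      LinkTiling.IsTriangulation (LinkTiling.pointsOff a Q)
        (LinkTiling.chQ a Q) (⋃ r : ℕ, LinkTiling.linkSimplices a P Q r)) ∧
    LinkTiling.IsTriangulation (LinkTiling.pointsOff a Q)
      (LinkTiling.linkRegion a P Q) (LinkTiling.linkSimplices a P Q Q.card) := by
  refine ⟨hP.isTriangulation_regionE Q, fun h => ⟨⟨hP.iUnion_regionE_eq_chQ h,
    fun r s hrs => hP.disjoint_interior_regionE Q hrs, _,
    fun r => (hP.isTriangulation_regionE Q r).toIsSubdivision,
    (hP.isTriangulation_chQ h).toIsSubdivision⟩, hP.isTriangulation_chQ h⟩,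
    hP.isTriangulation_regionE Q Q.card⟩
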